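/- **Setting.** Consider a finite extensive-form game with perfect recall, chance moves, and three players $\mathsf{T1},\mathsf{T2},\mathsf{O}$; $\mathsf{T1},\mathsf{T2}$ form a team against the opponent $\mathsf{O}$, and the payoffs are zero-sum: $u_{\mathsf{T1}}+u_{\mathsf{T2}}+u_{\mathsf{O}}=0$ at every leaf. Let $Z$ be the set of leaves, $p_{\mathsf c}(z)$ the product of the chance probabilities on the path to $z$, and $\hat u_{\mathsf T}(z)=(u_{\mathsf{T1}}(z)+u_{\mathsf{T2}}(z))\,p_{\mathsf c}(z)$. For a player $i$, let $\mathcal I_i$ be the set of information sets (infosets), $A_I$ the set of actions at $I\in\mathcal I_i$, and $\Sigma_i=\{(I,a):I\in\mathcal I_i,\ a\in A_I\}\cup\{\varnothing\}$ the set of sequences. For a leaf $z$ (or infoset $I\in\mathcal I_i$), $\sigma_i(z)$ (or $\sigma_i(I)$) is the last infoset-action pair of player $i$ on the path from the root to $z$ (or to any node of $I$), and $\varnothing$ if there is none. Let $\Pi_i$ be the set of reduced-normal-form plans of player $i$ (a choice of an action at exactly those infosets of $i$ that are still reachable given the other choices of the plan), $\Pi_i(z)\subseteq\Pi_i$ the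 set of plans that prescribe all actions of $i$ on the path to $z$, $\Pi_i(\varnothing)=\Pi_i$, and $\Pi_i((I,a))$ the set of plans that prescribe all actions of $i$ on the path to $I$ and the action $a$ at $I$. For $\mu_{\mathsf T}\in\Delta(\Pi_{\mathsf{T1}}\times\Pi_{\mathsf{T2}})$ and $\mu_{\mathsf O}\in\Delta(\Pi_{\mathsf O})$ put $$u_{\mathsf T}(\mu_{\mathsf T},\mu_{\mathsf O})=\sum_{z\in Z}\hat u_{\mathsf T}(z)\Big(\sum_{\pi_1\in\Pi_{\mathsf{T1}}(z),\,\pi_2\in\Pi_{\mathsf{T2}}(z)}\mu_{\mathsf T}(\pi_1,\pi_2)\Big)\Big(\sum_{\pi\in\Pi_{\mathsf O}(z)}\mu_{\mathsf O}(\pi)\Big).$$ A distribution $\mu_{\mathsf T}$ is a *TMECor* (team-maxmin equilibrium with coordination device) if it attains $\max_{\mu_{\mathsf T}}\min_{\mu_{\mathsf O}}u_{\mathsf T}(\mu_{\mathsf T},\mu_{\mathsf O})$. A pair $(\sigma_1,\sigma_2)\in\Sigma_{\mathsf{T1}}\times\Sigma_{\mathsf{T2}}$ is *relevant* if one of the two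 is $\varnothing$, or if $\sigma_1=(I,a)$, $\sigma_2=(J,b)$ and some path starting at the root meets both $I$ and $J$. The *extensive-form correlation plan* induced by $\mu_{\mathsf T}$ is the vector indexed by the relevant pairs with entries $$\xi_{\mathsf T}[\sigma_1,\sigma_2]=\sum_{\pi_1\in\Pi_{\mathsf{T1}}(\sigma_1),\,\pi_2\in\Pi_{\mathsf{T2}}(\sigma_2)}\mu_{\mathsf T}(\pi_1,\pi_2),$$ and $\Xi_{\mathsf T}$ is the set of all vectors so induced. A correlation plan is called a TMECor if it is induced by a distribution $\mu_{\mathsf T}$ that is a TMECor. **Proposition.** An extensive-form correlation plan $\xi_{\mathsf T}$ is a TMECor if and only if it is a solution of the linear program $$\begin{aligned} \operatorname*{arg\,max}_{\xi_{\mathsf T}}\quad & v_\varnothing\qquad\text{subject to}\\ (1)\quad & v_I-\sum_{I'\in\mathcal I_{\mathsf O}:\,\sigma_{\mathsf O}(I')=(I,a)}v_{I'}\le\sum_{z\in Z:\,\sigma_{\mathsf O}(z)=(I,a)}\hat u_{\mathsf T}(z)\,\xi_{\mathsf T}[\sigma_{\mathsf{T1}}(z),\sigma_{\mathsf{T2}}(z)]\quad\text{for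 all }(I,a)\in\Sigma_{\mathsf O}\setminus\{\varnothing\},\\ (2)\quad & v_\varnothing-\sum_{I'\in\mathcal I_{\mathsf O}:\,\sigma_{\mathsf O}(I')=\varnothing}v_{I'}\le\sum_{z\in Z:\,\sigma_{\mathsf O}(z)=\varnothing}\hat u_{\mathsf T}(z)\,\xi_{\mathsf T}[\sigma_{\mathsf{T1}}(z),\sigma_{\mathsf{T2}}(z)],\\ (3)\quad & v_\varnothing\in\mathbb R,\quad v_I\in\mathbb R\ \text{ for all }I\in\mathcal I_{\mathsf O},\\ (4)\quad & \xi_{\mathsf T}\in\Xi_{\mathsf T}, \end{aligned}$$ that is, if and only if there are values of $v_\varnothing$ and $(v_I)_{I\in\mathcal I_{\mathsf O}}$ that together with $\xi_{\mathsf T}$ form a feasible point with the largest value of $v_\varnothing$ among all feasible points. -/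

import Mathlib

/-- The three players: the two team members `T1`, `T2` and the opponent `O`. -/
inductive Player where
  | T1 : Player
  | T2 : Player
  | O : Player
  deriving DecidableEq

instance : Fintype Player where
  elems := {Player.T1, Player.T2, Player.O}
  complete i := by cases i <;> simp

/-- A finite three-player zero-sum extensive-form game with chance moves, with edges of the game
tree labelled by elements of `Act`. A node of the tree is the list of the actions leading to it
from the root, *last action first*: the root is `[]`, the child of `v` under the action `a` is
`a :: v`, and the nodes on the path from the root to `v` are the suffixes of `v`.
The nodes without available actions are the leaves. -/
structure TeamGame (Act : Type*) [DecidableEq Act] where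
  /-- the nodes of the game tree -/
  nodes : Finset (List Act)
  /-- the actions available at a node -/
  actions : List Act → Finset Act
  root_mem : [] ∈ nodes
  cons_mem_iff : ∀ v a, a :: v ∈ nodes ↔ v ∈ nodes ∧ a ∈ actions v
  /-- who moves at an internal node; `none` stands for the chance player -/
  turn : List Act → Option Player
  /-- the probability with which chance selects an action at one of its nodes -/
  chanceProb : List Act → Act → ℝ
  chanceProb_nonneg : ∀ v ∈ nodes, turn v = none → ∀ a ∈ actions v, 0 ≤ chanceProb v a
  chanceProb_sum : ∀ v ∈ nodes, (actions v).Nonempty → turn v = none →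
    ∑ a ∈ actions v, chanceProb v a = 1
  /-- the infosets of a player: a partition of the player's internal nodes into non-empty sets -/
  infosets : ∀ i : Player,
    Finpartition (nodes.filter fun v => (actions v).Nonempty ∧ turn v = some i)
  actions_eq : ∀ i, ∀ I ∈ (infosets i).parts, ∀ v ∈ I, ∀ w ∈ I, actions v = actions w
  /-- the payoff of a player at a leaf -/
  payoff : Player → List Act → ℝ
  zero_sum : ∀ z ∈ nodes, actions z = ∅ → ∑ i, payoff i z = 0

namespace TeamGame

variable {Act : Type*} [DecidableEq Act] (G : TeamGame Act)

/-- The set `Z` of leaves. -/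
def leaves : Finset (List Act) := G.nodes.filter fun z => G.actions z = ∅

/-- The product of the probabilities of the chance moves on the path from the root. -/
def chanceReach : List Act → ℝ
  | [] => 1
  | a :: v => chanceReach v * (if G.turn v = none then G.chanceProb v a else 1)

/-- The collection of infosets of player `i`, as a type. -/
abbrev Infoset (i : Player) : Type _ := {I : Finset (List Act) // I ∈ (G.infosets i).parts}

variable {G} in
/-- The set `A_I` of the actions available at the nodes of the infoset `I`. -/
def infoActions {i : Player} (I : G.Infoset i) : Finset Act := I.1.biUnion G.actions

theorem infoActions_eq {i : Player} (I : G.Infoset i) {v : List Act} (hv : v ∈ I.1) :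
    infoActions I = G.actions v := by
  ext a
  simp only [infoActions, Finset.mem_biUnion]
  constructor
  · rintro ⟨w, hw, ha⟩
    rwa [G.actions_eq i I.1 I.2 v hv w hw]
  · exact fun ha => ⟨v, hv, ha⟩

/-- The infoset-action pairs `(I, a)` of player `i`. -/
abbrev Move (i : Player) : Type _ := Σ I : G.Infoset i, {a : Act // a ∈ infoActions I}

/-- The set `Σ_i` of sequences of player `i`; `none` is the empty sequence. -/
abbrev Seq (i : Player) : Type _ := Option (G.Move i)

/-- Player `i` moves at the node `v`, and the action `a` is available there. -/
def IsMove (i : Player) (v : List Act) (a : Act) : Prop :=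
  v ∈ G.nodes ∧ a ∈ G.actions v ∧ G.turn v = some i

instance (i : Player) (v : List Act) (a : Act) : Decidable (G.IsMove i v a) := by
  unfold IsMove; infer_instance

theorem IsMove.mem_filter {i : Player} {v : List Act} {a : Act} (h : G.IsMove i v a) :
    v ∈ G.nodes.filter fun v => (G.actions v).Nonempty ∧ G.turn v = some i :=
  Finset.mem_filter.2 ⟨h.1, ⟨a, h.2.1⟩, h.2.2⟩

/-- The pair `(I, a)`, where `I` is the infoset of player `i` containing `v`. -/
def moveOf {i : Player} {v : List Act} {a : Act} (h : G.IsMove i v a) : G.Move i :=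
  ⟨⟨(G.infosets i).part v, (G.infosets i).part_mem.2 h.mem_filter⟩,
    ⟨a, Finset.mem_biUnion.2 ⟨v, (G.infosets i).mem_part h.mem_filter, h.2.1⟩⟩⟩

/-- The infoset-action pairs of player `i` encountered on the path from the root to a node,
last one first. -/
def experience (i : Player) : List Act → List (G.Move i)
  | [] => []
  | a :: v => if h : G.IsMove i v a then G.moveOf h :: experience i v else experience i v

/-- The last sequence `σ_i(v)` of player `i` encountered on the path from the root to `v`. -/
def seqOf (i : Player) (v : List Act) : G.Seq i := (G.experience i v).head?

/-- No player forgets what he or she knew and did earlier: the nodes of an infoset are reached by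
one and the same series of infosets and actions of the player. -/
def PerfectRecall : Prop :=
  ∀ (i : Player) (I : G.Infoset i), ∀ v ∈ I.1, ∀ w ∈ I.1, G.experience i v = G.experience i w

theorem infoset_nonempty {i : Player} (I : G.Infoset i) : I.1.Nonempty :=
  (G.infosets i).nonempty_of_mem_parts I.2

variable {G} in
/-- The parent sequence `σ(I)` of an infoset: the parent sequence of the nodes of `I`
(the same for all of them, under perfect recall). -/
noncomputable def parentSeq {i : Player} (I : G.Infoset i) : G.Seq i :=
  G.seqOf i (G.infoset_nonempty I).choose

theorem parentSeq_eq (hG : G.PerfectRecall) {i : Player} (I : G.Infoset i) {v : List Act}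
    (hv : v ∈ I.1) : parentSeq I = G.seqOf i v :=
  congrArg List.head? (hG i I _ (G.infoset_nonempty I).choose_spec v hv)

variable {G} in
/-- Two infosets are connected if some path from the root meets both. -/
def Connected {i j : Player} (I : G.Infoset i) (J : G.Infoset j) : Prop :=
  ∃ v ∈ I.1, ∃ w ∈ J.1, v <:+ w ∨ w <:+ v

variable {G} in
/-- Relevant pairs of sequences. -/
def Relevant {i j : Player} : G.Seq i → G.Seq j → Prop
  | none, _ => True
  | some _, none => True
  | some s, some t => Connected s.1 t.1

/-- The set of relevant pairs of sequences of the two team members. -/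
abbrev RelPair : Type _ := {p : G.Seq .T1 × G.Seq .T2 // Relevant p.1 p.2}

theorem exists_of_seqOf {i : Player} {z : List Act} {s : G.Move i} (h : G.seqOf i z = some s) :
    ∃ v ∈ s.1.1, v <:+ z := by
  induction z with
  | nil => simp [seqOf, experience] at h
  | cons a v ih =>
    by_cases hm : G.IsMove i v a
    · have hs : G.moveOf hm = s := by simpa [seqOf, experience, hm] using h
      subst hs
      exact ⟨v, (G.infosets i).mem_part hm.mem_filter, List.suffix_cons a v⟩
    · obtain ⟨w, hw, hwv⟩ := ih (by simpa [seqOf, experience, hm] using h)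
      exact ⟨w, hw, hwv.trans (List.suffix_cons a v)⟩

theorem relevant_seqOf (z : List Act) : Relevant (G.seqOf .T1 z) (G.seqOf .T2 z) := by
  cases h1 : G.seqOf .T1 z with
  | none => trivial
  | some s =>
    cases h2 : G.seqOf .T2 z with
    | none => trivial
    | some t =>
      obtain ⟨v, hv, hvz⟩ := G.exists_of_seqOf h1
      obtain ⟨w, hw, hwz⟩ := G.exists_of_seqOf h2
      exact ⟨v, hv, w, hw, List.suffix_or_suffix_of_suffix hvz hwz⟩

/-- The relevant pair `(σ_T1(z), σ_T2(z))`. -/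
def leafPair (z : List Act) : G.RelPair := ⟨(G.seqOf .T1 z, G.seqOf .T2 z), G.relevant_seqOf z⟩

/-- A partial choice of an action at each infoset of player `i`. -/
abbrev PartialPlan (i : Player) : Type _ :=
  ∀ I : G.Infoset i, Option {a : Act // a ∈ infoActions I}

variable {G} in
/-- The partial plan prescribes all the actions of player `i` on the path from the root to `v`. -/
def PlaysTo {i : Player} (π : G.PartialPlan i) (v : List Act) : Prop :=
  ∀ s ∈ G.experience i v, π s.1 = some s.2

variable {G} in
/-- The partial plan prescribes all the actions of player `i` on the path from the root to the
infoset `I`. -/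
def Reaches {i : Player} (π : G.PartialPlan i) (I : G.Infoset i) : Prop :=
  ∃ v ∈ I.1, PlaysTo π v

/-- The set `Π_i` of reduced-normal-form plans of player `i`: an action is chosen exactly at those
infosets of player `i` that are still reachable as a result of the other choices of the plan. -/
def Plan (i : Player) : Type _ :=
  {π : G.PartialPlan i // ∀ I, (π I).isSome ↔ Reaches π I}

open Classical in
noncomputable instance (i : Player) : Fintype (G.Plan i) :=
  inferInstanceAs (Fintype {π : G.PartialPlan i // ∀ I, (π I).isSome ↔ Reaches π I})

variable {G} in
/-- Membership of a plan in `Π_i(σ)`. -/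
def PlaysSeq {i : Player} (π : G.Plan i) : G.Seq i → Prop
  | none => True
  | some s => Reaches π.1 s.1 ∧ π.1 s.1 = some s.2

open Classical in
/-- The set `Π_i(σ)`. -/
noncomputable def plansSeq (i : Player) (σ : G.Seq i) : Finset (G.Plan i) :=
  Finset.univ.filter fun π => PlaysSeq π σ

open Classical in
/-- The set `Π_i(z)` of the plans of player `i` that play so as to reach `z`. -/
noncomputable def plansLeaf (i : Player) (z : List Act) : Finset (G.Plan i) :=
  Finset.univ.filter fun π => PlaysTo π.1 z

/-- `Δ(Π_T1 × Π_T2)`: the correlated distributions of play of the team. -/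
def teamDist : Set (G.Plan .T1 × G.Plan .T2 → ℝ) := stdSimplex ℝ (G.Plan .T1 × G.Plan .T2)

/-- `Δ(Π_O)`: the mixed strategies of the opponent. -/
def oppDist : Set (G.Plan .O → ℝ) := stdSimplex ℝ (G.Plan .O)

/-- The payoff of the team at a leaf, weighted by the chance probability of the leaf. -/
def uHat (z : List Act) : ℝ := (G.payoff .T1 z + G.payoff .T2 z) * G.chanceReach z

/-- The expected utility of the team. -/
noncomputable def teamUtility (μT : G.Plan .T1 × G.Plan .T2 → ℝ) (μO : G.Plan .O → ℝ) : ℝ :=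
  ∑ z ∈ G.leaves, G.uHat z *
    (∑ π₁ ∈ G.plansLeaf .T1 z, ∑ π₂ ∈ G.plansLeaf .T2 z, μT (π₁, π₂)) *
    (∑ π ∈ G.plansLeaf .O z, μO π)

/-- `w` is the minimum expected utility of the team playing `μT`, over all the strategies of the
opponent; that is, the utility of the team against a best-responding opponent. -/
def IsMinUtility (μT : G.Plan .T1 × G.Plan .T2 → ℝ) (w : ℝ) : Prop :=
  IsLeast (G.teamUtility μT '' G.oppDist) w

/-- A TMECor: a correlated distribution of play of the team that attains
`max_{μT} min_{μO} u_T(μT, μO)`. -/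
def IsTMECorDist (μT : G.Plan .T1 × G.Plan .T2 → ℝ) : Prop :=
  μT ∈ G.teamDist ∧ ∃ w, G.IsMinUtility μT w ∧
    ∀ μT' ∈ G.teamDist, ∀ w', G.IsMinUtility μT' w' → w' ≤ w

/-- The vector, indexed by the relevant sequence pairs of the team members, that is induced by a
correlated distribution of play of the team. -/
noncomputable def corrPlan (μT : G.Plan .T1 × G.Plan .T2 → ℝ) : G.RelPair → ℝ := fun p =>
  ∑ π₁ ∈ G.plansSeq .T1 p.1.1, ∑ π₂ ∈ G.plansSeq .T2 p.1.2, μT (π₁, π₂)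

/-- The polytope `Ξ_T` of extensive-form correlation plans of the team. -/
def corrPolytope : Set (G.RelPair → ℝ) := G.corrPlan '' G.teamDist

/-- A correlation plan is a TMECor if it is induced by a distribution of play that is a TMECor. -/
def IsTMECor (ξ : G.RelPair → ℝ) : Prop := ∃ μT, G.IsTMECorDist μT ∧ G.corrPlan μT = ξ

open Classical in
/-- Feasibility of `(ξ, v_∅, (v_I)_I)` for the linear program. -/
def LPFeasible (ξ : G.RelPair → ℝ) (v₀ : ℝ) (v : G.Infoset .O → ℝ) : Prop :=
  (∀ s : G.Move .O,
    v s.1 - ∑ I' : G.Infoset .O with parentSeq I' = some s, v I' ≤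
      ∑ z ∈ G.leaves with G.seqOf .O z = some s, G.uHat z * ξ (G.leafPair z)) ∧
  (v₀ - ∑ I' : G.Infoset .O with parentSeq I' = none, v I' ≤
      ∑ z ∈ G.leaves with G.seqOf .O z = none, G.uHat z * ξ (G.leafPair z)) ∧
  ξ ∈ G.corrPolytope

/-- `ξ` is a solution of the linear program: together with suitable values of the remaining
variables it maximises `v_∅` over all feasible points. -/
def IsLPSolution (ξ : G.RelPair → ℝ) : Prop :=
  ∃ v₀ v, G.LPFeasible ξ v₀ v ∧ ∀ ξ' v₀' v', G.LPFeasible ξ' v₀' v' → v₀' ≤ v₀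

end TeamGame

namespace TeamGame

variable {Act : Type*} [DecidableEq Act] {G : TeamGame Act}

/-! ### Experiences, sequences and plans -/

/-! By perfect recall the utility depends on the team's distribution only through its correlation
plan `ξ` and is an average over opponent plans (`teamUtility_eq`). For fixed `ξ` the opponent thus
faces a one-player tree problem, and the constraints bound each `v_I` by its continuation value.

Summing them over the sequences that a plan plays telescopes to `v_∅`, which is therefore at most
the utility against that plan (`le_teamUtility`). Backward induction makes every constraint used by
some plan tight (`exists_backward_values`). So for fixed `ξ` the largest feasible `v_∅` is the
team's minimum utility; maximising over `Ξ_T` gives both directions. -/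

theorem exists_cons_experience_suffix {i : Player} {z : List Act} {s : G.Move i}
    (h : s ∈ G.experience i z) :
    ∃ v ∈ s.1.1, s :: G.experience i v <:+ G.experience i z := by
  induction z with
  | nil => simp [experience] at h
  | cons a v ih =>
    by_cases hm : G.IsMove i v a
    · rw [experience, dif_pos hm] at h ⊢
      rcases List.mem_cons.1 h with rfl | h
      · exact ⟨v, (G.infosets i).mem_part hm.mem_filter, List.suffix_rfl⟩
      · obtain ⟨w, hw, hs⟩ := ih h
        exact ⟨w, hw, hs.trans (List.suffix_cons _ _)⟩
    · rw [experience, dif_neg hm] at h ⊢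
      exact ih h

theorem exists_experience_eq_cons {i : Player} {z : List Act} {s : G.Move i}
    (h : G.seqOf i z = some s) : ∃ v ∈ s.1.1, G.experience i z = s :: G.experience i v := by
  induction z with
  | nil => simp [seqOf, experience] at h
  | cons a v ih =>
    by_cases hm : G.IsMove i v a
    · have hs : G.moveOf hm = s := by simpa [seqOf, experience, hm] using h
      subst hs
      exact ⟨v, (G.infosets i).mem_part hm.mem_filter, by simp [experience, hm]⟩
    · obtain ⟨w, hw, hs⟩ := ih (by simpa [seqOf, experience, hm] using h)
      exact ⟨w, hw, by simpa [experience, hm] using hs⟩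

theorem PerfectRecall.reaches_iff (hG : G.PerfectRecall) {i : Player} {π : G.PartialPlan i}
    {I : G.Infoset i} {v : List Act} (hv : v ∈ I.1) : Reaches π I ↔ PlaysTo π v := by
  refine ⟨?_, fun h => ⟨v, hv, h⟩⟩
  rintro ⟨w, hw, h⟩
  rwa [PlaysTo, hG i I v hv w hw]

/-- The experience at `z` is its last move on top of the experience at a node of that move's
infoset, so the last move and its infoset's reachability encode it all. -/
theorem PerfectRecall.playsSeq_seqOf (hG : G.PerfectRecall) {i : Player} (π : G.Plan i)
    (z : List Act) : PlaysSeq π (G.seqOf i z) ↔ PlaysTo π.1 z := by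
  cases h : G.seqOf i z with
  | none =>
    have : G.experience i z = [] := List.head?_eq_none_iff.1 h
    simp [PlaysSeq, PlaysTo, this]
  | some s =>
    obtain ⟨v, hv, hz⟩ := exists_experience_eq_cons h
    simp only [PlaysSeq, hG.reaches_iff hv, PlaysTo, hz, List.forall_mem_cons]
    exact and_comm

theorem PerfectRecall.playsSeq_parentSeq (hG : G.PerfectRecall) {i : Player} (π : G.Plan i)
    (I : G.Infoset i) : PlaysSeq π (parentSeq I) ↔ Reaches π.1 I := by
  have hv := (G.infoset_nonempty I).choose_spec
  rw [parentSeq, hG.playsSeq_seqOf, hG.reaches_iff hv]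

theorem PerfectRecall.plansSeq_seqOf (hG : G.PerfectRecall) (i : Player) (z : List Act) :
    G.plansSeq i (G.seqOf i z) = G.plansLeaf i z := by
  ext π
  simp [plansSeq, plansLeaf, hG.playsSeq_seqOf]

theorem infoActions_nonempty {i : Player} (I : G.Infoset i) :
    Nonempty {a : Act // a ∈ infoActions I} := by
  obtain ⟨v, hv⟩ := G.infoset_nonempty I
  obtain ⟨a, ha⟩ := (Finset.mem_filter.1 ((G.infosets i).le I.2 hv)).2.1
  exact ⟨⟨a, by rwa [infoActions_eq G I hv]⟩⟩

/-- The number of moves player `i` has made before the infoset `I`. -/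
noncomputable def infosetDepth {i : Player} (I : G.Infoset i) : ℕ :=
  (G.experience i (G.infoset_nonempty I).choose).length

/-- Depth is the termination measure of the backward induction. -/
theorem PerfectRecall.infosetDepth_lt (hG : G.PerfectRecall) {i : Player} {I : G.Infoset i}
    {s : G.Move i} (h : parentSeq I = some s) : infosetDepth s.1 < infosetDepth I := by
  obtain ⟨v, hv, hz⟩ := exists_experience_eq_cons h
  rw [infosetDepth, infosetDepth, hz, hG i s.1 _ (G.infoset_nonempty s.1).choose_spec v hv,
    List.length_cons]
  exact Nat.lt_succ_self _

/-- A full choice of actions, restricted to the infosets it can reach, is a plan. -/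
theorem exists_plan_of_choice {i : Player} (α : ∀ I : G.Infoset i, {a // a ∈ infoActions I}) :
    ∃ π : G.Plan i, ∀ I a, π.1 I = some a → a = α I := by
  classical
  -- Reachability is tested with `α`, since `p` is not yet defined; that the two notions agree is
  -- what remains to be shown.
  let R : G.Infoset i → Prop := fun I => ∃ v ∈ I.1, ∀ s ∈ G.experience i v, α s.1 = s.2
  let p : G.PartialPlan i := fun I => if R I then some (α I) else none
  have hp : ∀ I a, p I = some a → a = α I := by
    intro I a h
    by_cases hR : R I
    · simpa [p, hR, eq_comm] using h
    · simp [p, hR] at h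
  refine ⟨⟨p, fun I => ?_⟩, hp⟩
  have hs : (p I).isSome ↔ R I := by by_cases hR : R I <;> simp [p, hR]
  rw [hs]
  constructor
  · rintro ⟨v, hv, h⟩
    refine ⟨v, hv, fun s hsv => ?_⟩
    -- An earlier infoset on the way to `v` is itself reached by `α`: some node of it has a suffix
    -- of the experience at `v`.
    obtain ⟨w, hw, hwv⟩ := exists_cons_experience_suffix hsv
    have hR : R s.1 := ⟨w, hw, fun t ht => h t (hwv.subset (List.mem_cons_of_mem _ ht))⟩
    simp [p, hR, h s hsv]
  · rintro ⟨v, hv, h⟩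
    exact ⟨v, hv, fun s hsv => (hp _ _ (h s hsv)).symm⟩

/-! ### Sums over the sequences played by a plan -/

open Classical in
theorem PerfectRecall.sum_played_leaves (hG : G.PerfectRecall) {i : Player} (π : G.Plan i)
    (c : List Act → ℝ) :
    ∑ σ : G.Seq i with PlaysSeq π σ, ∑ z ∈ G.leaves with G.seqOf i z = σ, c z =
      ∑ z ∈ G.leaves with PlaysTo π.1 z, c z := by
  rw [Finset.sum_fiberwise_eq_sum_filter]
  simp [hG.playsSeq_seqOf]

open Classical in
theorem PerfectRecall.sum_played_children (hG : G.PerfectRecall) {i : Player} (π : G.Plan i)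
    (v : G.Infoset i → ℝ) :
    ∑ σ : G.Seq i with PlaysSeq π σ, ∑ I : G.Infoset i with parentSeq I = σ, v I =
      ∑ I : G.Infoset i with Reaches π.1 I, v I := by
  rw [Finset.sum_fiberwise_eq_sum_filter]
  simp [hG.playsSeq_parentSeq]

open Classical in
-- A reduced plan plays exactly one move at each infoset it reaches and none elsewhere.
theorem sum_played_moves {i : Player} (π : G.Plan i) (v₀ : ℝ) (v : G.Infoset i → ℝ) :
    ∑ σ : G.Seq i with PlaysSeq π σ, σ.elim v₀ (fun s => v s.1) =
      v₀ + ∑ I : G.Infoset i with Reaches π.1 I, v I := by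
  rw [Finset.sum_filter, Fintype.sum_option, Fintype.sum_sigma, Finset.sum_filter]
  congr 1
  · simp [PlaysSeq]
  · refine Finset.sum_congr rfl fun I _ => ?_
    by_cases hR : Reaches π.1 I
    · obtain ⟨a, ha⟩ := Option.isSome_iff_exists.1 ((π.2 I).2 hR)
      simp [PlaysSeq, hR, ha]
    · simp [PlaysSeq, hR]

open Classical in
-- The telescoping: each reached infoset counts once through the move played there and once,
-- negatively, as a child of a played sequence. The summands are the left sides of the program's
-- constraints.
theorem PerfectRecall.sum_played_slack (hG : G.PerfectRecall) {i : Player} (π : G.Plan i)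
    (v₀ : ℝ) (v : G.Infoset i → ℝ) :
    ∑ σ : G.Seq i with PlaysSeq π σ,
      (σ.elim v₀ (fun s => v s.1) - ∑ I : G.Infoset i with parentSeq I = σ, v I) = v₀ := by
  rw [Finset.sum_sub_distrib, sum_played_moves, hG.sum_played_children]
  ring

/-! ### Backward induction -/

open Classical in
/-- The backward-induction values of a player who minimises the sum of the leaf costs `c`. -/
theorem PerfectRecall.exists_backward_values (hG : G.PerfectRecall) (i : Player)
    (c : List Act → ℝ) :
    ∃ (v : G.Infoset i → ℝ) (α : ∀ I : G.Infoset i, {a // a ∈ infoActions I}),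
      (∀ s : G.Move i, v s.1 - ∑ I : G.Infoset i with parentSeq I = some s, v I ≤
        ∑ z ∈ G.leaves with G.seqOf i z = some s, c z) ∧
      ∀ I, v I - ∑ I' : G.Infoset i with parentSeq I' = some ⟨I, α I⟩, v I' =
        ∑ z ∈ G.leaves with G.seqOf i z = some ⟨I, α I⟩, c z := by
  have := fun I : G.Infoset i => infoActions_nonempty I
  let F : ∀ I : G.Infoset i, (∀ I', infosetDepth I < infosetDepth I' → ℝ) → ℝ := fun I rec =>
    Finset.univ.inf' Finset.univ_nonempty fun a : {a // a ∈ infoActions I} =>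
      ∑ z ∈ G.leaves with G.seqOf i z = some ⟨I, a⟩, c z +
        ∑ I' : G.Infoset i,
          if h : parentSeq I' = some ⟨I, a⟩ then rec I' (hG.infosetDepth_lt h) else 0
  -- Deeper infosets come first; finiteness makes this order well-founded.
  have wf : WellFounded fun I' I : G.Infoset i => infosetDepth I < infosetDepth I' :=
    have : IsTrans (G.Infoset i) fun I' I => infosetDepth I < infosetDepth I' :=
      ⟨fun _ _ _ h h' => h'.trans h⟩
    have : Std.Irrefl fun I' I : G.Infoset i => infosetDepth I < infosetDepth I' :=
      ⟨fun _ => lt_irrefl _⟩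
    Finite.wellFounded_of_trans_of_irrefl _
  let v := wf.fix F
  have hv : ∀ I, v I = Finset.univ.inf' Finset.univ_nonempty fun a : {a // a ∈ infoActions I} =>
      ∑ z ∈ G.leaves with G.seqOf i z = some ⟨I, a⟩, c z +
        ∑ I' : G.Infoset i with parentSeq I' = some ⟨I, a⟩, v I' := by
    intro I
    -- Only the sums over infosets become conditional, matching the form used in `F`.
    simp only [Finset.sum_filter (fun I' : G.Infoset i => _)]
    exact (wf.fix_eq F I)
  have hα : ∀ I, ∃ a : {a // a ∈ infoActions I}, v I =
      ∑ z ∈ G.leaves with G.seqOf i z = some ⟨I, a⟩, c z +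
        ∑ I' : G.Infoset i with parentSeq I' = some ⟨I, a⟩, v I' := fun I => by
    rw [hv I]
    obtain ⟨a, -, ha⟩ := Finset.exists_mem_eq_inf' (Finset.univ_nonempty
      (α := {a // a ∈ infoActions I})) fun a =>
        ∑ z ∈ G.leaves with G.seqOf i z = some ⟨I, a⟩, c z +
          ∑ I' : G.Infoset i with parentSeq I' = some ⟨I, a⟩, v I'
    exact ⟨a, ha⟩
  choose α hα using hα
  refine ⟨v, α, fun ⟨I, a⟩ => ?_, fun I => sub_eq_iff_eq_add.2 (hα I)⟩
  rw [sub_le_iff_le_add, hv I]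
  exact Finset.inf'_le _ (Finset.mem_univ a)

/-! ### The linear program and the utility of the team -/

open Classical in
theorem PerfectRecall.teamUtility_eq (hG : G.PerfectRecall)
    (μT : G.Plan .T1 × G.Plan .T2 → ℝ) (μO : G.Plan .O → ℝ) :
    G.teamUtility μT μO = ∑ π, μO π *
      ∑ z ∈ G.leaves with PlaysTo π.1 z, G.uHat z * G.corrPlan μT (G.leafPair z) := by
  simp only [teamUtility, corrPlan, leafPair, hG.plansSeq_seqOf, Finset.sum_filter,
    Finset.mul_sum _ _ (μO _)]
  rw [Finset.sum_comm]
  refine Finset.sum_congr rfl fun z _ => ?_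
  rw [plansLeaf.eq_def G .O, Finset.sum_filter, Finset.mul_sum]
  refine Finset.sum_congr rfl fun π _ => ?_
  split_ifs <;> ring

open Classical in
/-- Weak duality: `v_∅` is a lower bound for the utility of the team. -/
theorem PerfectRecall.le_teamUtility (hG : G.PerfectRecall)
    {μT : G.Plan .T1 × G.Plan .T2 → ℝ} {v₀ : ℝ} {v : G.Infoset .O → ℝ}
    (h : G.LPFeasible (G.corrPlan μT) v₀ v) {μO : G.Plan .O → ℝ} (hμ : μO ∈ G.oppDist) :
    v₀ ≤ G.teamUtility μT μO := by
  rw [hG.teamUtility_eq]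
  calc v₀ = ∑ π, μO π * v₀ := by rw [← Finset.sum_mul, hμ.2, one_mul]
    _ ≤ _ := Finset.sum_le_sum fun π _ => mul_le_mul_of_nonneg_left ?_ (hμ.1 π)
  -- Against a single plan, add up the constraints of the sequences it plays.
  rw [← hG.sum_played_leaves]
  refine (hG.sum_played_slack π v₀ v).symm.trans_le (Finset.sum_le_sum fun σ _ => ?_)
  cases σ with
  | none => exact h.2.1
  | some s => exact h.1 s

open Classical in
/-- Strong duality: for the correlation plan induced by `μT`, the minimum utility of the team is
an attainable value of `v_∅`. -/
theorem PerfectRecall.exists_isMinUtility_lpFeasible (hG : G.PerfectRecall)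
    {μT : G.Plan .T1 × G.Plan .T2 → ℝ} (hμ : μT ∈ G.teamDist) :
    ∃ w v, G.IsMinUtility μT w ∧ G.LPFeasible (G.corrPlan μT) w v := by
  let c : List Act → ℝ := fun z => G.uHat z * G.corrPlan μT (G.leafPair z)
  obtain ⟨v, α, hle, heq⟩ := hG.exists_backward_values .O c
  obtain ⟨π, hπ⟩ := exists_plan_of_choice α
  -- This value makes the root constraint tight.
  let w := ∑ z ∈ G.leaves with G.seqOf .O z = none, c z +
    ∑ I : G.Infoset .O with parentSeq I = none, v I
  have hf : G.LPFeasible (G.corrPlan μT) w v :=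
    ⟨hle, (add_sub_cancel_right _ _).le, μT, hμ, rfl⟩
  refine ⟨w, v, ⟨⟨Pi.single π 1, single_mem_stdSimplex ℝ π, ?_⟩, ?_⟩, hf⟩
  · rw [hG.teamUtility_eq]
    simp only [Pi.single_apply, ite_mul, one_mul, zero_mul, Finset.sum_ite_eq', Finset.mem_univ,
      if_true]
    rw [← hG.sum_played_leaves]
    refine Eq.trans (Finset.sum_congr rfl fun σ hσ => ?_) (hG.sum_played_slack π w v)
    cases σ with
    | none => exact (add_sub_cancel_right _ _).symm
    | some s =>
      obtain ⟨I, a⟩ := s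
      -- Every move that `π` plays is the minimising one, where the constraint is an equality.
      obtain rfl := hπ I a (Finset.mem_filter.1 hσ).2.2
      exact (heq I).symm
  · rintro _ ⟨μO, hO, rfl⟩
    exact hG.le_teamUtility hf hO

theorem PerfectRecall.le_of_lpFeasible (hG : G.PerfectRecall)
    {μT : G.Plan .T1 × G.Plan .T2 → ℝ} {w v₀ : ℝ} {v : G.Infoset .O → ℝ}
    (hw : G.IsMinUtility μT w) (h : G.LPFeasible (G.corrPlan μT) v₀ v) : v₀ ≤ w := by
  obtain ⟨μO, hO, rfl⟩ := hw.1
  exact hG.le_teamUtility h hO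

theorem PerfectRecall.exists_lpFeasible (hG : G.PerfectRecall)
    {μT : G.Plan .T1 × G.Plan .T2 → ℝ} (hμ : μT ∈ G.teamDist) {w : ℝ}
    (hw : G.IsMinUtility μT w) : ∃ v, G.LPFeasible (G.corrPlan μT) w v := by
  obtain ⟨w', v, hw', hf⟩ := hG.exists_isMinUtility_lpFeasible hμ
  exact ⟨v, hw.unique hw' ▸ hf⟩

end TeamGame

theorem mainTheorem1 {Act : Type*} [DecidableEq Act] (G : TeamGame Act) (hG : G.PerfectRecall)
    (ξ : G.RelPair → ℝ) : G.IsTMECor ξ ↔ G.IsLPSolution ξ := by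
  constructor
  · rintro ⟨μT, ⟨hμ, w, hw, hmax⟩, rfl⟩
    obtain ⟨v, hf⟩ := hG.exists_lpFeasible hμ hw
    refine ⟨w, v, hf, fun ξ' v₀' v' hf' => ?_⟩
    obtain ⟨μT', hμ', rfl⟩ := hf'.2.2
    obtain ⟨w', -, hw', -⟩ := hG.exists_isMinUtility_lpFeasible hμ'
    exact (hG.le_of_lpFeasible hw' hf').trans (hmax μT' hμ' w' hw')
  · rintro ⟨v₀, v, hf, hmax⟩
    -- Any distribution inducing `ξ` will do, as the minimum utility depends on `ξ` alone.
    obtain ⟨μT, hμ, rfl⟩ := hf.2.2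
    obtain ⟨w, -, hw, -⟩ := hG.exists_isMinUtility_lpFeasible hμ
    refine ⟨μT, ⟨hμ, w, hw, fun μT' hμ' w' hw' => ?_⟩, rfl⟩
    obtain ⟨v', hf'⟩ := hG.exists_lpFeasible hμ' hw'
    exact (hmax _ _ _ hf').trans (hG.le_of_lpFeasible hw hf)
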